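/- **Proposition 7.4.** An oriented graph is a directed graph without loops in which any two vertices are joined by at most one arc. Let $H$ be a fixed finite oriented graph containing a directed cycle. For an oriented graph $F$, let $v(F)$, $e(F)$ and $s(F)$ denote the numbers of its vertices, of its edges and of its strongly connected components (single vertices are allowed as components). Let $$m_2(H)=\max\left\{\frac{e(F)-1}{v(F)-2} : F\subset H,\ v(F)\ge 3\right\}$$ be the $2$-density of $H$. For a graph $G$, let $D(G,H)$ be the number of orientations of $G$ that contain no (not necessarily induced) copy of $H$. Let $p=p(n)\in[0,1]$ satisfy $p\gg n^{-1/m_2(H)}$, that is, $p\cdot n^{1/m_2(H)}\to\infty$ as $n\to\infty$, and let $\omega=\omega(n)\to\infty$. Then, with probability tending to $1$ as $n\to\infty$, the binomial random graph $G(n,p)$ satisfies $$\log D\big(G(n,p),H\big)\;\ge\;\frac{pn}{\omega}\cdot\max\left\{\Big(p^{e(F)-1}\,n^{s(F)-1}\Big)^{-\frac{1}{v(F)-s(F)-1}} : F\subset H,\ v(F)\ge s(F)+2\right\},$$ where $\log$ is the natural logarithm, and both maxima are over all (not necessarily induced) subgraphs $F$ of $H$. -/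

import Mathlib

open Filter Topology

namespace Digraph

variable {V : Type*}

/-- A digraph is an oriented graph if no pair of vertices carries arcs in both directions;
in particular (taking `u = v`) it has no loops. -/
def IsOriented (G : Digraph V) : Prop :=
  ∀ u v, G.Adj u v → ¬ G.Adj v u

/-- `O` is an orientation of the simple graph `G`: an oriented graph on the same vertices whose
underlying graph is `G`. -/
def IsOrientationOf (O : Digraph V) (G : SimpleGraph V) : Prop :=
  O.IsOriented ∧ ∀ u v, G.Adj u v ↔ O.Adj u v ∨ O.Adj v u

/-- `O` contains a (not necessarily induced) copy of `H`. -/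
def ContainsCopy {W : Type*} (H : Digraph V) (O : Digraph W) : Prop :=
  ∃ f : V → W, Function.Injective f ∧ ∀ u v, H.Adj u v → O.Adj (f u) (f v)

/-- `H` contains a directed cycle, with vertices `c 0, c 1, …, c (k - 1)` for some `k ≥ 3`. -/
def HasDirectedCycle (H : Digraph V) : Prop :=
  ∃ k : ℕ, 3 ≤ k ∧ ∃ c : ZMod k → V, Function.Injective c ∧ ∀ i, H.Adj (c i) (c (i + 1))

/-- A subgraph of a digraph: a set of vertices, and a set of arcs between them. -/
@[ext]
structure Subgraph (H : Digraph V) where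
  verts : Set V
  Adj : V → V → Prop
  adj_sub : ∀ {u v}, Adj u v → H.Adj u v
  fst_mem : ∀ {u v}, Adj u v → u ∈ verts
  snd_mem : ∀ {u v}, Adj u v → v ∈ verts

namespace Subgraph

variable {H : Digraph V}

/-- The number of vertices. -/
noncomputable def numVerts (F : H.Subgraph) : ℕ := F.verts.ncard

/-- The number of arcs. -/
noncomputable def numEdges (F : H.Subgraph) : ℕ := {a : V × V | F.Adj a.1 a.2}.ncard

/-- Two vertices of `F` are equivalent if there are directed walks in `F` from each of them to the
other. The equivalence classes are the strongly connected components of `F`. -/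
def strongSetoid (F : H.Subgraph) : Setoid F.verts where
  r u v := Relation.ReflTransGen F.Adj u v ∧ Relation.ReflTransGen F.Adj v u
  iseqv :=
    { refl := fun _ => ⟨.refl, .refl⟩
      symm := fun h => ⟨h.2, h.1⟩
      trans := fun h₁ h₂ => ⟨h₁.1.trans h₂.1, h₂.2.trans h₁.2⟩ }

/-- The number of strongly connected components (single vertices are allowed). -/
noncomputable def numStrongComps (F : H.Subgraph) : ℕ := Nat.card (Quotient F.strongSetoid)

end Subgraph

/-- The `2`-density `m₂(H)`: the maximum of `(e(F) - 1) / (v(F) - 2)` over the subgraphs `F` of `H`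
with at least three vertices. For finite `H` on at least three vertices the set is finite and
nonempty, so that the supremum is a maximum. -/
noncomputable def twoDensity (H : Digraph V) : ℝ :=
  sSup {x : ℝ | ∃ F : H.Subgraph, 3 ≤ F.numVerts ∧
    x = ((F.numEdges : ℝ) - 1) / ((F.numVerts : ℝ) - 2)}

/-- The maximum of `(p ^ (e(F) - 1) n ^ (s(F) - 1)) ^ (-1 / (v(F) - s(F) - 1))` over the subgraphs
`F` of `H` with `v(F) ≥ s(F) + 2`. For finite `H` the set is finite; it is nonempty if `H` contains
a directed cycle, so that the supremum is a maximum. -/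
noncomputable def lowerBoundMax (H : Digraph V) (p : ℝ) (n : ℕ) : ℝ :=
  sSup {x : ℝ | ∃ F : H.Subgraph, F.numStrongComps + 2 ≤ F.numVerts ∧
    x = (p ^ ((F.numEdges : ℝ) - 1) * (n : ℝ) ^ ((F.numStrongComps : ℝ) - 1)) ^
      (-1 / ((F.numVerts : ℝ) - (F.numStrongComps : ℝ) - 1))}

/-- `D(G, H)`: the number of orientations of `G` that contain no copy of `H`. -/
noncomputable def numFreeOrientations {W : Type*} (G : SimpleGraph W) (H : Digraph V) : ℕ :=
  {O : Digraph W | O.IsOrientationOf G ∧ ¬ H.ContainsCopy O}.ncard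

end Digraph

/-! Fix one subgraph F with v(F) ≥ s(F) + 2 and cut the vertices 1, …, n into intervals of length m.
Orient every edge upwards, except that some edges inside blocks may be flipped. Along the arcs of
any copy of F the block index never decreases, so each strong component of F lies in one block.
Discard the in-block edges that lie in such a block-respecting copy of F in G. If only surviving
edges are flipped, a copy of F would have all its arcs pointing upwards, impossible because F has a
nontrivial strong component. With E the surviving set, this gives 2^|E| H-free orientations
(`two_pow_card_le_numFreeOrientations`).

There are about nmp in-block edges (Chebyshev) and at most n^s m^(v-s) p^e expected block-respecting
copies (Markov, `ncard_blockMaps_le`). Up to a constant the ratio is m^(v-s-1) p^(e-1) n^(s-1),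
which equals 1 when m is the term x of F in the maximum. Taking m of order x/ω makes the ratio
O(1/ω), so log D is at least of order nmp. The density hypothesis gives x ≤ n and pn → ∞. A union
bound over the finitely many F finishes the proof. -/

namespace SimpleGraph

/-! ### First and second moment estimates in the binomial random graph -/

open MeasureTheory ProbabilityTheory

instance discreteMeasurableSpace_of_finite {V : Type*} [Finite V] :
    DiscreteMeasurableSpace (SimpleGraph V) where
  forall_measurableSet S := by
    rw [← Set.preimage_image_eq S edgeSet_injective]
    exact measurable_edgeSet .of_discrete

/-- The edges come from independent coins, and loops are thrown away; hence `T` must avoid the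
diagonal. -/
lemma binomialRandom_real_superset {V : Type*} [Finite V] (p : unitInterval)
    (T : Finset (Sym2 V)) (hT : ∀ e ∈ T, ¬ e.IsDiag) :
    (binomialRandom V p).real {G | ↑T ⊆ G.edgeSet} = (p : ℝ) ^ T.card := by
  have h2 : (binomialRandom V p) {G | ↑T ⊆ G.edgeSet} =
      ((unitInterval.toNNReal p : NNReal) : ENNReal) ^ T.card := by
    rw [binomialRandom_eq_map, Measure.map_apply measurable_fromEdgeSet .of_discrete,
      setBernoulli_apply']
    have : ((fun p : Sym2 V → Prop ↦ {i | p i}) ⁻¹'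
        (fromEdgeSet ⁻¹' {G : SimpleGraph V | ↑T ⊆ G.edgeSet})) =
        Set.pi (T : Set (Sym2 V)) (fun _ => {True}) := by
      ext q
      simp only [Set.mem_preimage, Set.mem_ofPred_eq, edgeSet_fromEdgeSet, Set.mem_pi,
        Set.mem_singleton_iff, Set.subset_def, Set.mem_sdiff, Finset.mem_coe, eq_iff_iff, iff_true]
      exact ⟨fun h e he => (h e he).1, fun h e he => ⟨h e he, fun hd => hT e he hd⟩⟩
    rw [this, Measure.infinitePi_pi _ (fun _ _ => .of_discrete)]
    rw [Finset.prod_congr rfl (g := fun _ => ((unitInterval.toNNReal p : NNReal) : ENNReal)),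
      Finset.prod_const]
    intro e he
    simp [hT e he]
  rw [measureReal_def, h2]
  simp

section Concentration

variable {V : Type*}

open Classical in
/-- The edges of `G` that belong to `S`. -/
noncomputable def edgesIn (S : Finset (Sym2 V)) (G : SimpleGraph V) : Finset (Sym2 V) :=
  S.filter (· ∈ G.edgeSet)

lemma card_edgesIn_eq (S : Finset (Sym2 V)) (G : SimpleGraph V) :
    ((edgesIn S G).card : ℝ) =
      ∑ e ∈ S, Set.indicator {G : SimpleGraph V | ↑({e} : Finset (Sym2 V)) ⊆ G.edgeSet} 1 G := by
  classical
  simp [edgesIn, Set.indicator_apply]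

variable [Finite V] (p : unitInterval)

lemma integral_indicator_superset (T : Finset (Sym2 V)) (hT : ∀ e ∈ T, ¬ e.IsDiag) :
    ∫ G, Set.indicator {G : SimpleGraph V | ↑T ⊆ G.edgeSet} (1 : SimpleGraph V → ℝ) G
      ∂(binomialRandom V p) = (p : ℝ) ^ T.card := by
  rw [integral_indicator_one .of_discrete, binomialRandom_real_superset p T hT]

lemma integral_card_edgesIn (S : Finset (Sym2 V)) (hS : ∀ e ∈ S, ¬ e.IsDiag) :
    ∫ G, ((edgesIn S G).card : ℝ) ∂(binomialRandom V p) = S.card * (p : ℝ) := by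
  simp_rw [card_edgesIn_eq]
  rw [integral_finsetSum _ (fun _ _ => .of_finite), Finset.sum_congr rfl
    (fun e he => integral_indicator_superset p {e} (by simpa using hS e he))]
  simp

lemma integral_card_edgesIn_sq_le (S : Finset (Sym2 V)) (hS : ∀ e ∈ S, ¬ e.IsDiag) :
    ∫ G, ((edgesIn S G).card : ℝ) ^ 2 ∂(binomialRandom V p) ≤
      S.card * (p : ℝ) + (S.card * (p : ℝ)) ^ 2 := by
  classical
  have h : ∀ G : SimpleGraph V, ((edgesIn S G).card : ℝ) ^ 2 = ∑ e ∈ S, ∑ e' ∈ S,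
      Set.indicator {G : SimpleGraph V | ↑({e, e'} : Finset (Sym2 V)) ⊆ G.edgeSet} 1 G := by
    intro G
    rw [sq, card_edgesIn_eq, Finset.sum_mul_sum]
    refine Finset.sum_congr rfl fun e _ => Finset.sum_congr rfl fun e' _ => ?_
    simp only [Set.indicator_apply, Set.mem_ofPred_eq, Finset.coe_singleton,
      Set.singleton_subset_iff, Finset.coe_pair, Set.insert_subset_iff, Pi.one_apply]
    split_ifs <;> simp_all
  have hp0 : (0 : ℝ) ≤ p := p.2.1
  simp_rw [h]
  rw [integral_finsetSum _ (fun _ _ => .of_finite)]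
  calc _ ≤ ∑ e ∈ S, ∑ e' ∈ S, ((if e = e' then (p : ℝ) else 0) + (p : ℝ) ^ 2) := by
        refine Finset.sum_le_sum fun e he => ?_
        rw [integral_finsetSum _ (fun _ _ => .of_finite)]
        refine Finset.sum_le_sum fun e' he' => ?_
        rw [integral_indicator_superset p {e, e'} (by simp [hS e he, hS e' he'])]
        by_cases hee : e = e'
        · subst hee
          simp [sq_nonneg]
        · simp [hee]
    _ = _ := by
        simp only [Finset.sum_add_distrib, Finset.sum_ite_eq, Finset.sum_const, nsmul_eq_mul]
        rw [Finset.sum_congr rfl (g := fun _ => (p : ℝ)) (by intro x hx; simp [hx])]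
        simp only [Finset.sum_const, nsmul_eq_mul]
        ring

/-- Chebyshev's inequality: the variance is at most the mean. -/
lemma real_card_edgesIn_lt_half_le (S : Finset (Sym2 V)) (hS : ∀ e ∈ S, ¬ e.IsDiag)
    (hpos : 0 < S.card * (p : ℝ)) :
    (binomialRandom V p).real {G | ((edgesIn S G).card : ℝ) < S.card * (p : ℝ) / 2} ≤
      4 / (S.card * (p : ℝ)) := by
  set c := S.card * (p : ℝ) with hc
  have h1 := mul_meas_ge_le_integral_of_nonneg (μ := binomialRandom V p)
    (f := fun G => (((edgesIn S G).card : ℝ) - c) ^ 2)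
    (Eventually.of_forall fun _ => sq_nonneg _) .of_finite ((c / 2) ^ 2)
  have h2 : ∫ G, (((edgesIn S G).card : ℝ) - c) ^ 2 ∂(binomialRandom V p) ≤ c := by
    have : ∀ G, (((edgesIn S G).card : ℝ) - c) ^ 2 =
        ((edgesIn S G).card : ℝ) ^ 2 + (c ^ 2 - 2 * c * ((edgesIn S G).card : ℝ)) := by
      intro G; ring
    simp_rw [this]
    rw [integral_add .of_finite .of_finite, integral_sub .of_finite .of_finite,
      integral_const_mul, integral_card_edgesIn p S hS]
    have := integral_card_edgesIn_sq_le p S hS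
    simp only [integral_const, probReal_univ, smul_eq_mul, one_mul, ← hc] at this ⊢
    linarith
  have h3 : (binomialRandom V p).real {G | ((edgesIn S G).card : ℝ) < c / 2} ≤
      (binomialRandom V p).real {G | (c / 2) ^ 2 ≤ (((edgesIn S G).card : ℝ) - c) ^ 2} := by
    refine measureReal_mono fun G hG => ?_
    simp only [Set.mem_ofPred_eq] at hG ⊢
    nlinarith
  rw [le_div_iff₀ hpos]
  nlinarith

open Classical in
/-- Markov's inequality for the number of members of a family of edge sets contained in a binomial
random graph. -/
lemma real_lt_card_filter_superset_le {ι : Type*} (C : Finset ι) (T : ι → Finset (Sym2 V))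
    (hT : ∀ i ∈ C, ∀ e ∈ T i, ¬ e.IsDiag) (k : ℕ) (hk : ∀ i ∈ C, (T i).card = k) {t : ℝ}
    (ht : 0 < t) :
    (binomialRandom V p).real
      {G | t < ((C.filter (fun i => (↑(T i) : Set (Sym2 V)) ⊆ G.edgeSet)).card : ℝ)} ≤
      C.card * (p : ℝ) ^ k / t := by
  classical
  have h1 := mul_meas_ge_le_integral_of_nonneg (μ := binomialRandom V p)
    (f := fun G => ∑ i ∈ C, Set.indicator {G : SimpleGraph V | ↑(T i) ⊆ G.edgeSet} (1 : SimpleGraph V → ℝ) G)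
    (Eventually.of_forall fun _ => Finset.sum_nonneg fun _ _ =>
      Set.indicator_nonneg (by simp) _) .of_finite t
  rw [integral_finsetSum _ (fun _ _ => .of_finite), Finset.sum_congr rfl
    (fun i hi => integral_indicator_superset p (T i) (hT i hi)),
    Finset.sum_congr rfl (fun i hi => by rw [hk i hi]), Finset.sum_const, nsmul_eq_mul] at h1
  rw [le_div_iff₀ ht, mul_comm]
  refine le_trans (mul_le_mul_of_nonneg_left (measureReal_mono fun G hG => ?_) ht.le) h1
  simp only [Set.mem_ofPred_eq, Set.indicator_apply, Pi.one_apply, Finset.sum_boole] at hG ⊢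
  exact (le_of_lt hG).trans (le_of_eq (by congr))

end Concentration

end SimpleGraph

/-! ### Orientations obtained by flipping edges inside blocks -/

namespace Digraph

section Orientations

variable {W : Type*} [LinearOrder W]

/-- The orientation of `G` in which the edges outside `A` point to the larger endpoint and the edges
in `A` point to the smaller endpoint. -/
def flipOrientation (G : SimpleGraph W) (A : Set (Sym2 W)) : Digraph W where
  Adj x y := G.Adj x y ∧ ((s(x, y) ∈ A ∧ y < x) ∨ (s(x, y) ∉ A ∧ x < y))

lemma flipOrientation_isOrientationOf (G : SimpleGraph W) (A : Set (Sym2 W)) :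
    (flipOrientation G A).IsOrientationOf G := by
  refine ⟨?_, ?_⟩
  · rintro u v ⟨-, h⟩ ⟨-, h'⟩
    rw [Sym2.eq_swap] at h'
    rcases h with ⟨h1, h2⟩ | ⟨h1, h2⟩ <;> rcases h' with ⟨h3, h4⟩ | ⟨h3, h4⟩
    exacts [lt_asymm h2 h4, h3 h1, h1 h3, lt_asymm h2 h4]
  · intro u v
    refine ⟨fun h => ?_, ?_⟩
    · simp only [flipOrientation, h, h.symm, true_and, Sym2.eq_swap (a := v) (b := u)]
      have := lt_or_gt_of_ne h.ne
      tauto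
    · rintro (h | h)
      exacts [h.1, h.1.symm]

/-- The set `A` can be read off as the set of edges that point downwards. -/
lemma flipOrientation_injOn (G : SimpleGraph W) :
    Set.InjOn (flipOrientation G) {A | A ⊆ G.edgeSet} := by
  have key : ∀ A B : Set (Sym2 W), A ⊆ G.edgeSet → flipOrientation G A = flipOrientation G B →
      A ⊆ B := by
    intro A B hA hAB e he
    have hG := hA he
    induction e with | _ x y =>
    have h1 : ∀ x y, s(x, y) ∈ A → G.Adj x y → y < x → s(x, y) ∈ B := by
      intro x y hx hxy hlt
      have : (flipOrientation G A).Adj x y := ⟨hxy, Or.inl ⟨hx, hlt⟩⟩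
      rw [hAB] at this
      rcases this.2 with h | h
      exacts [h.1, absurd hlt h.2.not_gt]
    rcases lt_or_gt_of_ne (SimpleGraph.Adj.ne hG) with h | h
    · rw [Sym2.eq_swap] at he ⊢
      exact h1 y x he (SimpleGraph.Adj.symm hG) h
    · exact h1 x y he hG h
  intro A hA B hB h
  exact (key A B hA h).antisymm (key B A hB h.symm)

end Orientations

variable {V : Type*} {H : Digraph V}

namespace Subgraph

/-- `f` is injective and maps each strongly connected component of `F` into a fibre of `b`. -/
def IsBlockEmbedding {W : Type*} (F : H.Subgraph) (b : W → ℕ) (f : F.verts → W) : Prop :=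
  Function.Injective f ∧ ∀ u v, F.strongSetoid u v → b (f u) = b (f v)

/-- Used twice below: with the block index of the image, and with the image vertex itself. -/
lemma le_of_reflTransGen {F : H.Subgraph} {α : Type*} [Preorder α] {g : F.verts → α}
    (h : ∀ u v : F.verts, F.Adj u v → g u ≤ g v) {u v : F.verts}
    (huv : Relation.ReflTransGen F.Adj (u : V) v) : g u ≤ g v := by
  have : ∀ w : V, Relation.ReflTransGen F.Adj (u : V) w → ∀ hw : w ∈ F.verts, g u ≤ g ⟨w, hw⟩ := by
    intro w hw
    induction hw with
    | refl => exact fun _ => le_rfl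
    | tail _ hab ih => exact fun hw => (ih (F.fst_mem hab)).trans (h ⟨_, F.fst_mem hab⟩ ⟨_, hw⟩ hab)
  exact this v huv v.2

variable {W : Type*} [LinearOrder W]

/-- Block indices are monotone along arcs, so strong components stay inside blocks and `hsafe`
applies. Then no arc of the copy is flipped, and the walks between `u₀` and `v₀` in both directions
force their images to coincide. -/
lemma not_containsCopy_flipOrientation (F : H.Subgraph) {u₀ v₀ : F.verts} (hne : u₀ ≠ v₀)
    (hequiv : F.strongSetoid u₀ v₀) (G : SimpleGraph W) {b : W → ℕ} (hb : Monotone b)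
    {A : Set (Sym2 W)} (hA : ∀ x y, s(x, y) ∈ A → b x = b y)
    (hsafe : ∀ f : F.verts → W, F.IsBlockEmbedding b f →
      (∀ u v : F.verts, F.Adj u v → G.Adj (f u) (f v)) →
      ∀ u v : F.verts, F.Adj u v → s(f u, f v) ∉ A) :
    ¬ H.ContainsCopy (flipOrientation G A) := by
  rintro ⟨f, hf, hfH⟩
  have hO : ∀ u v : F.verts, F.Adj u v → (flipOrientation G A).Adj (f u) (f v) :=
    fun u v h => hfH u v (F.adj_sub h)
  have hmono : ∀ u v : F.verts, F.Adj u v → b (f u) ≤ b (f v) := by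
    intro u v h
    rcases (hO u v h).2 with h | h
    exacts [(hA _ _ h.1).le, hb h.2.le]
  have hblock : F.IsBlockEmbedding b (fun u => f u) :=
    ⟨fun u v h => Subtype.ext (hf h), fun u v h =>
      (le_of_reflTransGen (g := fun u : F.verts => b (f u)) hmono h.1).antisymm
        (le_of_reflTransGen (g := fun u : F.verts => b (f u)) hmono h.2)⟩
  have hlt : ∀ u v : F.verts, F.Adj u v → f u ≤ f v := by
    intro u v h
    rcases (hO u v h).2 with h' | h'
    exacts [absurd h'.1 (hsafe _ hblock (fun u v h => (hO u v h).1) u v h), h'.2.le]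
  exact hne (hblock.1 ((le_of_reflTransGen (g := fun u : F.verts => f u) hlt hequiv.1).antisymm
    (le_of_reflTransGen (g := fun u : F.verts => f u) hlt hequiv.2)))

lemma two_pow_card_le_numFreeOrientations [Finite W] (F : H.Subgraph) {u₀ v₀ : F.verts}
    (hne : u₀ ≠ v₀) (hequiv : F.strongSetoid u₀ v₀) (G : SimpleGraph W) {b : W → ℕ}
    (hb : Monotone b) (E : Finset (Sym2 W)) (hEG : ↑E ⊆ G.edgeSet)
    (hE : ∀ x y, s(x, y) ∈ E → b x = b y)
    (hsafe : ∀ f : F.verts → W, F.IsBlockEmbedding b f →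
      (∀ u v : F.verts, F.Adj u v → G.Adj (f u) (f v)) →
      ∀ u v : F.verts, F.Adj u v → s(f u, f v) ∉ E) :
    2 ^ E.card ≤ numFreeOrientations G H := by
  rw [← Finset.card_powerset, ← Set.ncard_coe_finset, numFreeOrientations]
  have : Finite (Digraph W) := by
    classical
    have := Fintype.ofFinite W
    infer_instance
  refine Set.ncard_le_ncard_of_injOn (fun A : Finset (Sym2 W) => flipOrientation G ↑A) ?_ ?_
    (Set.toFinite _)
  · intro A hA
    have hAE : A ⊆ E := by simpa using hA
    exact ⟨flipOrientation_isOrientationOf _ _, not_containsCopy_flipOrientation F hne hequiv G hb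
      (fun x y h => hE x y (hAE h)) (fun f h1 h2 u v h h' => hsafe f h1 h2 u v h (hAE h'))⟩
  · intro A hA B hB h
    have hAE : A ⊆ E := by simpa using hA
    have hBE : B ⊆ E := by simpa using hB
    exact Finset.coe_injective (flipOrientation_injOn G (x₁ := (A : Set (Sym2 W)))
      (x₂ := (B : Set (Sym2 W))) (fun e he => hEG (hAE he)) (fun e he => hEG (hBE he)) h)

end Subgraph

end Digraph

/-! ### Counting pairs and maps that respect the blocks -/

/-- The pairs of distinct vertices in the same block, when `Fin n` is cut into intervals of
length `m`. -/
def blockPairs (n m : ℕ) : Finset (Sym2 (Fin n)) :=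
  Finset.univ.filter fun e => ¬ e.IsDiag ∧ ∀ x ∈ e, ∀ y ∈ e, (x : ℕ) / m = (y : ℕ) / m

lemma mk_mem_blockPairs {n m : ℕ} {x y : Fin n} :
    s(x, y) ∈ blockPairs n m ↔ x ≠ y ∧ (x : ℕ) / m = (y : ℕ) / m := by
  simp only [blockPairs, Finset.mem_filter, Finset.mem_univ, true_and, Sym2.mk_isDiag_iff,
    Sym2.mem_iff, forall_eq_or_imp, forall_eq, and_congr_right_iff, ne_eq]
  intro _
  constructor
  · tauto
  · intro h
    exact ⟨h, h.symm, trivial⟩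

/-- Only the `n / m` full blocks are counted; a shorter last block is ignored. -/
lemma div_mul_choose_le_card_blockPairs (n m : ℕ) :
    (n / m) * m.choose 2 ≤ (blockPairs n m).card := by
  classical
  have hlt : ∀ (q : Fin (n / m)) (i : Fin m), (q : ℕ) * m + i < n := by
    intro q i
    have h1 : ((q : ℕ) + 1) * m ≤ (n / m) * m := Nat.mul_le_mul_right _ q.2
    have h2 := Nat.div_mul_le_self n m
    have h3 := i.2
    rw [add_mul] at h1
    omega
  let g : Fin (n / m) → Fin m → Fin n := fun q i => ⟨q * m + i, hlt q i⟩
  have hgdiv : ∀ q i, (g q i : ℕ) / m = q := by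
    intro q i
    have : 0 < m := i.pos
    simp only [g]
    rw [mul_comm, Nat.mul_add_div this, Nat.div_eq_of_lt i.2, add_zero]
  have hginj : ∀ q, Function.Injective (g q) := by
    intro q i j h
    simpa [g, Fin.ext_iff] using h
  let Φ : Fin (n / m) × {a : Sym2 (Fin m) // ¬ a.IsDiag} → Sym2 (Fin n) := fun x => x.2.1.map (g x.1)
  have hΦ : Function.Injective Φ := by
    rintro ⟨q, a, ha⟩ ⟨q', a', ha'⟩ h
    simp only [Φ] at h
    have hq : q = q' := by
      induction a with | _ i j =>
      have : g q i ∈ a'.map (g q') := by rw [← h]; simp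
      obtain ⟨i', -, hi'⟩ := Sym2.mem_map.1 this
      exact Fin.ext (by rw [← hgdiv q i, ← hgdiv q' i', hi'])
    subst hq
    have := Sym2.map.injective (hginj q) h
    subst this
    rfl
  have := Finset.card_le_card_of_injOn (s := Finset.univ) (t := blockPairs n m) Φ ?_ hΦ.injOn
  · rwa [Finset.card_univ, Fintype.card_prod, Sym2.card_subtype_not_diag, Fintype.card_fin,
      Fintype.card_fin] at this
  · rintro ⟨q, a, ha⟩ -
    induction a with | _ i j =>
    simp only [Φ, Sym2.map_mk, Finset.mem_coe]
    rw [mk_mem_blockPairs]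
    exact ⟨fun h => ha (by simpa using hginj q h), by rw [hgdiv, hgdiv]⟩

lemma mul_div_eight_le_card_blockPairs {n m : ℕ} (hm : 2 ≤ m) (hmn : m ≤ n) :
    (n : ℝ) * m / 8 ≤ (blockPairs n m).card := by
  have h1 : ((n / m * m.choose 2 : ℕ) : ℝ) ≤ (blockPairs n m).card :=
    Nat.cast_le.2 (div_mul_choose_le_card_blockPairs n m)
  refine le_trans ?_ h1
  have h2 : (n : ℝ) ≤ 2 * ((n / m : ℕ) : ℝ) * m := by
    have h3 := Nat.div_add_mod n m
    have h4 := Nat.mod_lt n (by omega : 0 < m)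
    have h5 : 1 ≤ n / m := (Nat.one_le_div_iff (by omega)).2 hmn
    have : n ≤ 2 * (n / m) * m := by nlinarith
    exact_mod_cast this
  have hm' : (2 : ℝ) ≤ m := by exact_mod_cast hm
  rw [Nat.cast_mul, Nat.cast_choose_two]
  have h3 : (0 : ℝ) ≤ ((n / m : ℕ) : ℝ) := Nat.cast_nonneg _
  have h4 : (m : ℝ) / 4 ≤ (m - 1) / 2 := by linarith
  calc (n : ℝ) * m / 8 ≤ (2 * ((n / m : ℕ) : ℝ) * m) * m / 8 := by gcongr
    _ = ((n / m : ℕ) : ℝ) * (m * (m / 4)) := by ring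
    _ ≤ ((n / m : ℕ) : ℝ) * (m * ((m - 1) / 2)) := by gcongr
    _ = _ := by ring

/-- A bound on the number of maps to `Fin n` sending each class of `r` into a block of length `m`. -/
lemma ncard_blockMaps_le {α : Type*} [Finite α] (r : Setoid α) {n m : ℕ} (hm : 0 < m) :
    {f : α → Fin n | ∀ u v, r u v → (f u : ℕ) / m = (f v : ℕ) / m}.ncard ≤
      n ^ Nat.card (Quotient r) * m ^ (Nat.card α - Nat.card (Quotient r)) := by
  classical
  -- The vertices that are not the chosen representative of their class.
  let N := {u : α // (⟦u⟧ : Quotient r).out ≠ u}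
  have hcard : Nat.card α - Nat.card (Quotient r) = Nat.card N := by
    have h1 : Nat.card {u : α // (⟦u⟧ : Quotient r).out = u} = Nat.card (Quotient r) :=
      Nat.card_congr
        { toFun := fun u => ⟦u.1⟧
          invFun := fun q => ⟨q.out, by simp⟩
          left_inv := fun u => Subtype.ext u.2
          right_inv := fun q => by simp }
    have h2 := Nat.card_congr (Equiv.sumCompl fun u : α => (⟦u⟧ : Quotient r).out = u)
    rw [Nat.card_sum, h1] at h2
    change _ = Nat.card {u : α // ¬ (⟦u⟧ : Quotient r).out = u}
    omega
  -- Representatives record their full image; the others only its residue mod `m`, since their block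
  -- is that of the representative.
  let Ψ : (α → Fin n) → (Quotient r → Fin n) × (N → Fin m) := fun f =>
    (fun q => f q.out, fun u => ⟨(f u.1 : ℕ) % m, Nat.mod_lt _ hm⟩)
  have hΨ : Set.InjOn Ψ {f : α → Fin n | ∀ u v, r u v → (f u : ℕ) / m = (f v : ℕ) / m} := by
    intro f hf g hg h
    simp only [Ψ, Prod.mk.injEq] at h
    funext u
    have hout := congrFun h.1 ⟦u⟧
    by_cases hu : (⟦u⟧ : Quotient r).out = u
    · simpa only [hu] using hout
    · have hr : r (⟦u⟧ : Quotient r).out u := Quotient.mk_out u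
      have h1 := hf _ _ hr
      have h2 := hg _ _ hr
      have h3 := congrArg Fin.val (congrFun h.2 ⟨u, hu⟩)
      simp only at h3
      rw [hout] at h1
      refine Fin.ext ?_
      rw [← Nat.div_add_mod (f u : ℕ) m, ← h1, h2, h3, Nat.div_add_mod]
  calc _ ≤ (Set.univ : Set ((Quotient r → Fin n) × (N → Fin m))).ncard :=
        Set.ncard_le_ncard_of_injOn Ψ (fun _ _ => Set.mem_univ _) hΨ (Set.toFinite _)
    _ = _ := by
        rw [Set.ncard_univ, Nat.card_prod, Nat.card_fun, Nat.card_fun, Nat.card_fin, Nat.card_fin,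
          hcard]

/-! ### Free orientations of the random graph from a single subgraph -/

namespace Digraph.Subgraph

variable {V : Type*} {H : Digraph V}

lemma exists_adj_of_ne {F : H.Subgraph} {u v : F.verts} (hne : u ≠ v) (h : F.strongSetoid u v) :
    ∃ w : F.verts, F.Adj u w ∧ F.strongSetoid u w := by
  rcases Relation.ReflTransGen.cases_head h.1 with h' | ⟨w, hw, hwv⟩
  · exact absurd (Subtype.ext h') hne
  · exact ⟨⟨w, F.snd_mem hw⟩, hw, .single hw, hwv.trans h.2⟩

/-- Without antiparallel arcs a nontrivial strong component has at least three vertices, so it does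
not fit into a block of two. -/
lemma not_isBlockEmbedding_two (hH : H.IsOriented) {F : H.Subgraph} {u v : F.verts}
    (hne : u ≠ v) (h : F.strongSetoid u v) {n : ℕ} (f : F.verts → Fin n) :
    ¬ F.IsBlockEmbedding (fun i : Fin n => (i : ℕ) / 2) f := by
  rintro ⟨hinj, hf⟩
  have key : ∀ a b c : F.verts, a ≠ b → a ≠ c → b ≠ c → F.strongSetoid a b →
      ¬ F.strongSetoid a c := by
    intro a b c hab hac hbc h1 h2
    have e1 := hf a b h1
    have e2 := hf a c h2
    have n1 : (f a : ℕ) ≠ f b := fun h => hab (hinj (Fin.ext h))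
    have n2 : (f a : ℕ) ≠ f c := fun h => hac (hinj (Fin.ext h))
    have n3 : (f b : ℕ) ≠ f c := fun h => hbc (hinj (Fin.ext h))
    simp only at e1 e2
    omega
  have hirr : ∀ a b : F.verts, F.Adj a b → a ≠ b := by
    rintro a _ hab rfl
    exact hH _ _ (F.adj_sub hab) (F.adj_sub hab)
  have h' : F.strongSetoid v u := ⟨h.2, h.1⟩
  obtain ⟨w, hw, hw'⟩ := exists_adj_of_ne hne h
  obtain ⟨x, hx, hx'⟩ := exists_adj_of_ne hne.symm h'
  have e1 : w = v := by
    by_contra hwv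
    exact key u v w hne (hirr _ _ hw) (Ne.symm hwv) h hw'
  have e2 : x = u := by
    by_contra hxu
    exact key v u x hne.symm (hirr _ _ hx) (Ne.symm hxu) h' hx'
  subst e1 e2
  exact hH _ _ (F.adj_sub hw) (F.adj_sub hx)

variable [Finite V]

lemma exists_ne_equiv_of_numStrongComps_lt {F : H.Subgraph}
    (h : F.numStrongComps < F.numVerts) : ∃ u v : F.verts, u ≠ v ∧ F.strongSetoid u v := by
  by_contra! hcon
  have hinj : Function.Injective (fun u : F.verts => (⟦u⟧ : Quotient F.strongSetoid)) := by
    intro u v huv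
    by_contra hne
    exact hcon u v hne (Quotient.exact huv)
  have := Nat.card_le_card_of_injective _ hinj
  rw [Nat.card_coe_set_eq] at this
  exact absurd this (not_le.2 h)

lemma numEdges_pos {F : H.Subgraph} {u v : F.verts} (hne : u ≠ v) (h : F.strongSetoid u v) :
    0 < F.numEdges := by
  obtain ⟨w, hw, -⟩ := exists_adj_of_ne hne h
  exact (Set.ncard_pos (Set.toFinite _)).2 ⟨(↑u, ↑w), hw⟩

open Classical in
/-- The undirected edges of the image of `F` under `f`. -/
noncomputable def imageEdges (F : H.Subgraph) {W : Type*} (f : F.verts → W) : Finset (Sym2 W) :=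
  (Set.toFinite {a : F.verts × F.verts | F.Adj a.1 a.2}).toFinset.image fun a => s(f a.1, f a.2)

lemma mem_imageEdges {F : H.Subgraph} {W : Type*} {f : F.verts → W} {e : Sym2 W} :
    e ∈ F.imageEdges f ↔ ∃ u v : F.verts, F.Adj u v ∧ s(f u, f v) = e := by
  simp only [imageEdges, Finset.mem_image, Set.Finite.mem_toFinset, Set.mem_ofPred_eq,
    Prod.exists]

/-- Forgetting directions merges no two arcs, as `H` has no antiparallel pair. -/
lemma card_imageEdges (hH : H.IsOriented) (F : H.Subgraph) {W : Type*} {f : F.verts → W}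
    (hf : Function.Injective f) : (F.imageEdges f).card = F.numEdges := by
  classical
  rw [imageEdges, Finset.card_image_of_injOn, ← Set.ncard_eq_toFinset_card, numEdges]
  · refine Set.ncard_congr (fun a _ => (↑a.1, ↑a.2)) (fun a ha => ha) ?_ ?_
    · rintro ⟨a, b⟩ ⟨c, d⟩ - - h
      simpa [Subtype.ext_iff] using h
    · rintro ⟨a, b⟩ h
      exact ⟨(⟨a, F.fst_mem h⟩, ⟨b, F.snd_mem h⟩), h, rfl⟩
  · rintro ⟨a, b⟩ hab ⟨c, d⟩ hcd h
    simp only [Set.Finite.coe_toFinset, Set.mem_ofPred_eq] at hab hcd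
    simp only [Sym2.eq_iff] at h
    rcases h with ⟨h1, h2⟩ | ⟨h1, h2⟩
    · rw [hf h1, hf h2]
    · rw [hf h1, hf h2] at hab
      exact absurd (F.adj_sub hab) (hH _ _ (F.adj_sub hcd))

lemma not_isDiag_of_mem_imageEdges (hH : H.IsOriented) {F : H.Subgraph} {W : Type*}
    {f : F.verts → W} (hf : Function.Injective f) {e : Sym2 W} (he : e ∈ F.imageEdges f) :
    ¬ e.IsDiag := by
  obtain ⟨u, v, huv, rfl⟩ := mem_imageEdges.1 he
  intro h
  rw [Sym2.mk_isDiag_iff] at h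
  rw [hf h] at huv
  exact hH _ _ (F.adj_sub huv) (F.adj_sub huv)

open Classical in
-- Alteration: each copy from `C` present in `G` costs at most `F.numEdges` of the in-block edges,
-- and the rest may be flipped freely.
lemma card_sub_le_log_numFreeOrientations (hH : H.IsOriented) (F : H.Subgraph) {u₀ v₀ : F.verts}
    (hne : u₀ ≠ v₀) (hequiv : F.strongSetoid u₀ v₀) {n m : ℕ} (C : Finset (F.verts → Fin n))
    (hC : ∀ f, F.IsBlockEmbedding (fun i : Fin n => (i : ℕ) / m) f → f ∈ C)
    (hCinj : ∀ f ∈ C, Function.Injective f) (G : SimpleGraph (Fin n)) :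
    (((SimpleGraph.edgesIn (blockPairs n m) G).card : ℝ) - F.numEdges *
      ((C.filter fun f => (↑(F.imageEdges f) : Set (Sym2 (Fin n))) ⊆ G.edgeSet).card : ℝ)) *
        Real.log 2 ≤ Real.log (numFreeOrientations G H) := by
  set B := C.filter fun f => (↑(F.imageEdges f) : Set (Sym2 (Fin n))) ⊆ G.edgeSet with hB
  set E := SimpleGraph.edgesIn (blockPairs n m) G \ B.biUnion F.imageEdges with hE
  have hmemE : ∀ e, e ∈ E → e ∈ blockPairs n m ∧ e ∈ G.edgeSet := by
    intro e he
    simpa [SimpleGraph.edgesIn] using (Finset.mem_sdiff.1 he).1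
  have h1 := two_pow_card_le_numFreeOrientations F hne hequiv G
    (b := fun i : Fin n => (i : ℕ) / m) (fun i j hij => Nat.div_le_div_right hij) E
    (fun e he => (hmemE e he).2) (fun x y h => (mk_mem_blockPairs.1 (hmemE _ h).1).2) (by
      intro f hf hfG u v huv he
      refine (Finset.mem_sdiff.1 he).2 (Finset.mem_biUnion.2 ⟨f, ?_, mem_imageEdges.2
        ⟨u, v, huv, rfl⟩⟩)
      refine Finset.mem_filter.2 ⟨hC f hf, fun e he => ?_⟩
      obtain ⟨u, v, huv, rfl⟩ := mem_imageEdges.1 (Finset.mem_coe.1 he)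
      exact hfG u v huv)
  have h2 : (SimpleGraph.edgesIn (blockPairs n m) G).card ≤ E.card + F.numEdges * B.card := by
    have h3 : (B.biUnion F.imageEdges).card ≤ B.card * F.numEdges :=
      Finset.card_biUnion_le_card_mul _ _ _ fun f hf =>
        (card_imageEdges hH F (hCinj f (Finset.mem_filter.1 hf).1)).le
    have := Finset.le_card_sdiff (B.biUnion F.imageEdges) (SimpleGraph.edgesIn (blockPairs n m) G)
    rw [← hE] at this
    rw [mul_comm]
    omega
  have h2' : ((SimpleGraph.edgesIn (blockPairs n m) G).card : ℝ) ≤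
      E.card + F.numEdges * B.card := by exact_mod_cast h2
  calc _ ≤ (E.card : ℝ) * Real.log 2 :=
        mul_le_mul_of_nonneg_right (by linarith) (Real.log_nonneg one_le_two)
    _ = Real.log ((2 ^ E.card : ℕ) : ℝ) := by push_cast; rw [Real.log_pow]
    _ ≤ _ := Real.log_le_log (by positivity) (by exact_mod_cast h1)

/-- With failure probability controlled by the expected number of copies of `F` whose strong
components lie in blocks of length `m`, the random graph has `exp (n m p / 64)` free
orientations. -/
lemma real_log_numFreeOrientations_lt_le (hH : H.IsOriented) (F : H.Subgraph) {u₀ v₀ : F.verts}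
    (hne : u₀ ≠ v₀) (hequiv : F.strongSetoid u₀ v₀) {n m : ℕ} (hm : 2 ≤ m) (hmn : m ≤ n)
    (p : unitInterval) (hp : 0 < (p : ℝ)) (C : Finset (F.verts → Fin n))
    (hC : ∀ f, F.IsBlockEmbedding (fun i : Fin n => (i : ℕ) / m) f → f ∈ C)
    (hCinj : ∀ f ∈ C, Function.Injective f) :
    (SimpleGraph.binomialRandom (Fin n) p).real
      {G | Real.log (numFreeOrientations G H) < n * m * p / 64} ≤
      32 / (n * m * p) * (1 + F.numEdges * (C.card * (p : ℝ) ^ F.numEdges)) := by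
  classical
  set S := blockPairs n m with hS
  set c := (S.card : ℝ) * p with hc
  have hn0 : (0 : ℝ) < n := by exact_mod_cast (by omega : 0 < n)
  have hm0 : (0 : ℝ) < m := by exact_mod_cast (by omega : 0 < m)
  have hcge : (n : ℝ) * m * p / 8 ≤ c := by
    have := mul_le_mul_of_nonneg_right (mul_div_eight_le_card_blockPairs hm hmn) hp.le
    rw [← hS] at this
    linarith
  have hc0 : 0 < c := lt_of_lt_of_le (by positivity) hcge
  have he : (0 : ℝ) < F.numEdges := by exact_mod_cast numEdges_pos hne hequiv
  have h1 := SimpleGraph.real_card_edgesIn_lt_half_le p S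
    (fun e he => (Finset.mem_filter.1 he).2.1) hc0
  have h2 := SimpleGraph.real_lt_card_filter_superset_le p C F.imageEdges
    (fun f hf e he => not_isDiag_of_mem_imageEdges hH (hCinj f hf) he) F.numEdges
    -- With this threshold at most `c / 4` of the at least `c / 2` in-block edges are lost; `c ≥ n m
    -- p / 8` and `log 2 ≥ 1 / 2` then give the constant 64.
    (fun f hf => card_imageEdges hH F (hCinj f hf)) (t := c / (4 * F.numEdges)) (by positivity)
  have hsub : {G : SimpleGraph (Fin n) |
      Real.log (numFreeOrientations G H) < n * m * p / 64} ⊆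
      {G | ((SimpleGraph.edgesIn S G).card : ℝ) < c / 2} ∪
      {G | c / (4 * F.numEdges) <
        ((C.filter fun f => (↑(F.imageEdges f) : Set (Sym2 (Fin n))) ⊆ G.edgeSet).card : ℝ)} := by
    intro G hG
    by_contra hcon
    simp only [Set.mem_union, Set.mem_ofPred_eq, not_or, not_lt] at hcon hG
    obtain ⟨ha, hb⟩ := hcon
    have h3 := card_sub_le_log_numFreeOrientations hH F hne hequiv C hC hCinj G
    rw [le_div_iff₀ (by positivity)] at hb
    have h4 : c / 4 ≤ ((SimpleGraph.edgesIn (blockPairs n m) G).card : ℝ) - F.numEdges *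
        ((C.filter fun f => (↑(F.imageEdges f) : Set (Sym2 (Fin n))) ⊆ G.edgeSet).card : ℝ) := by
      rw [← hS]
      linarith
    have h5 : (1 / 2 : ℝ) ≤ Real.log 2 := by linarith [Real.log_two_gt_d9]
    have h6 := mul_le_mul h4 h5 (by norm_num) (le_trans (by positivity) h4)
    linarith
  refine (MeasureTheory.measureReal_mono hsub).trans
    ((MeasureTheory.measureReal_union_le _ _).trans ((add_le_add h1 h2).trans ?_))
  have h7 : (4 : ℝ) / c ≤ 32 / (n * m * p) := by
    rw [div_le_div_iff₀ hc0 (by positivity)]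
    linarith
  calc _ = 4 / c * (1 + F.numEdges * (C.card * (p : ℝ) ^ F.numEdges)) := by
        rw [← hc]
        field_simp
    _ ≤ _ := mul_le_mul_of_nonneg_right h7 (by positivity)

end Digraph.Subgraph

/-! ### The optimal block length -/

namespace Digraph

variable {V : Type*} {H : Digraph V}

namespace Subgraph

instance [Finite V] : Finite H.Subgraph :=
  Finite.of_injective (β := Set V × (V → V → Prop)) (fun F => (F.verts, F.Adj)) fun _ _ h =>
    Subgraph.ext (congrArg Prod.fst h) (congrArg Prod.snd h)

/-- The expression maximised in the lower bound. -/
noncomputable def lowerBoundTerm (F : H.Subgraph) (p : ℝ) (n : ℕ) : ℝ :=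
  (p ^ ((F.numEdges : ℝ) - 1) * (n : ℝ) ^ ((F.numStrongComps : ℝ) - 1)) ^
    (-1 / ((F.numVerts : ℝ) - (F.numStrongComps : ℝ) - 1))

lemma lowerBoundTerm_pos (F : H.Subgraph) {p : ℝ} (hp : 0 < p) {n : ℕ} (hn : 0 < n) :
    0 < F.lowerBoundTerm p n := by
  have : (0 : ℝ) < n := by exact_mod_cast hn
  unfold lowerBoundTerm
  positivity

/-- The equation characterising the critical block length. The shifted parameters make all exponents
natural numbers, with v - s - 1 = `d + 1`. -/
lemma lowerBoundTerm_pow_mul {F : H.Subgraph} {e s d : ℕ} (he : F.numEdges = e + 1)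
    (hs : F.numStrongComps = s + 1) (hv : F.numVerts = s + d + 3) {p : ℝ} (hp : 0 < p) {n : ℕ}
    (hn : 0 < n) : F.lowerBoundTerm p n ^ (d + 1) * (p ^ e * (n : ℝ) ^ s) = 1 := by
  have hn' : (0 : ℝ) < n := by exact_mod_cast hn
  have h1 : F.lowerBoundTerm p n = (p ^ e * (n : ℝ) ^ s) ^ (-1 / ((d + 1 : ℕ) : ℝ)) := by
    rw [lowerBoundTerm, he, hs, hv, ← Real.rpow_natCast p e, ← Real.rpow_natCast (n : ℝ) s]
    congr 2
    · congr 1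
      push_cast
      ring
    · congr 1
      push_cast
      ring
    · push_cast
      ring
  have hQ : 0 < p ^ e * (n : ℝ) ^ s := by positivity
  rw [h1, ← Real.rpow_mul_natCast hQ.le, div_mul_cancel₀ _ (by positivity), Real.rpow_neg_one,
    inv_mul_cancel₀ hQ.ne']

/-- Replacing the term by `n` in the previous equation turns its left side into that of `hdense`,
which is at least 1. -/
lemma lowerBoundTerm_le {F : H.Subgraph} {e s d : ℕ} (he : F.numEdges = e + 1)
    (hs : F.numStrongComps = s + 1) (hv : F.numVerts = s + d + 3) {p : ℝ} (hp : 0 < p) {n : ℕ}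
    (hn : 0 < n) (hdense : 1 ≤ p ^ (F.numEdges - 1) * (n : ℝ) ^ (F.numVerts - 2)) :
    F.lowerBoundTerm p n ≤ n := by
  have hn' : (0 : ℝ) < n := by exact_mod_cast hn
  have h1 := lowerBoundTerm_pow_mul he hs hv hp hn
  refine le_of_pow_le_pow_left₀ (by omega : d + 1 ≠ 0) hn'.le ?_
  have hQ : 0 < p ^ e * (n : ℝ) ^ s := by positivity
  refine le_of_mul_le_mul_right ?_ hQ
  rw [h1]
  refine hdense.trans (le_of_eq ?_)
  rw [he, hv, show s + d + 3 - 2 = d + 1 + s by omega, Nat.add_sub_cancel, pow_add]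
  ring

variable [Finite V]

lemma numStrongComps_pos {F : H.Subgraph} (h : F.numStrongComps < F.numVerts) :
    0 < F.numStrongComps := by
  obtain ⟨u, -, -, -⟩ := exists_ne_equiv_of_numStrongComps_lt h
  have : Nonempty (Quotient F.strongSetoid) := ⟨⟦u⟧⟩
  exact Nat.card_pos

/-- For a single subgraph `F`, the lower bound fails with small probability. -/
lemma real_log_lt_lowerBoundTerm_le (hH : H.IsOriented) (F : H.Subgraph)
    (hF : F.numStrongComps + 2 ≤ F.numVerts) {n : ℕ} (hn : 2 ≤ n) (p : unitInterval)
    (hp : 0 < (p : ℝ)) {w : ℝ} (hw : 192 ≤ w)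
    (hdense : 1 ≤ (p : ℝ) ^ (F.numEdges - 1) * (n : ℝ) ^ (F.numVerts - 2)) :
    (SimpleGraph.binomialRandom (Fin n) p).real
      {G | Real.log (numFreeOrientations G H) < p * n / w * F.lowerBoundTerm p n} ≤
      16 / (p * n) + F.numEdges * (6144 / w) := by
  classical
  obtain ⟨u, v, hne, hequiv⟩ := exists_ne_equiv_of_numStrongComps_lt (F := F) (by omega)
  have hw0 : 0 < w := by linarith
  have hn0 : (0 : ℝ) < n := by exact_mod_cast (by omega : 0 < n)
  obtain ⟨s, hs⟩ := Nat.exists_eq_add_of_lt (numStrongComps_pos (F := F) (by omega))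
  obtain ⟨e, he⟩ := Nat.exists_eq_add_of_lt (numEdges_pos hne hequiv)
  obtain ⟨d, hd⟩ := Nat.exists_eq_add_of_le hF
  rw [zero_add] at hs he
  replace hd : F.numVerts = s + d + 3 := by omega
  have hx0 := lowerBoundTerm_pos F hp (show 0 < n by omega)
  have hxn := lowerBoundTerm_le he hs hd hp (show 0 < n by omega) hdense
  have hxpow := lowerBoundTerm_pow_mul he hs hd hp (show 0 < n by omega)
  set x := F.lowerBoundTerm p n with hx
  rcases lt_or_ge x (w / 64) with hxw | hxw
  · have h1 := real_log_numFreeOrientations_lt_le hH F hne hequiv le_rfl hn p hp ∅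
      (fun f hf => absurd hf (not_isBlockEmbedding_two hH hne hequiv f)) (by simp)
    refine (MeasureTheory.measureReal_mono fun G hG => ?_).trans (h1.trans ?_)
    · simp only [Set.mem_ofPred_eq] at hG ⊢
      refine hG.trans_le ?_
      have : (p : ℝ) * n / w * x = p * n * (x / w) := by ring
      have h2 : x / w ≤ 1 / 64 := by rw [div_le_iff₀ hw0]; linarith
      have h3 := mul_le_mul_of_nonneg_left h2 (mul_pos hp hn0).le
      rw [this]
      push_cast
      nlinarith [mul_pos hp hn0]
    · have : (32 : ℝ) / (n * (2 : ℕ) * p) = 16 / (p * n) := by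
        push_cast
        field_simp
        norm_num
      rw [this]
      have : 0 ≤ (F.numEdges : ℝ) * (6144 / w) := by positivity
      simpa using this
  -- The factor 64 cancels the one lost in the counting bound, and the `+ 1` ensures `2 ≤ m`. As `64
  -- * x / w ≥ 1`, rounding costs at most a factor 3, whence 192.
  · set m := ⌈64 * x / w⌉₊ + 1 with hm
    have hy : 1 ≤ 64 * x / w := by rw [le_div_iff₀ hw0]; linarith
    have hmge : 64 * x / w ≤ m := by
      rw [hm]; push_cast; linarith [Nat.le_ceil (64 * x / w)]
    have hmle : (m : ℝ) ≤ 192 / w * x := by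
      have := Nat.ceil_lt_add_one (show 0 ≤ 64 * x / w by linarith)
      have h2 : 192 / w * x = 3 * (64 * x / w) := by ring
      rw [hm, h2]; push_cast; linarith
    have hδ : 192 / w ≤ 1 := by rw [div_le_one hw0]; exact hw
    have hm2 : 2 ≤ m := by
      have : 0 < ⌈64 * x / w⌉₊ := Nat.ceil_pos.2 (by linarith)
      omega
    have hmn : m ≤ n := by
      have : (m : ℝ) ≤ n := hmle.trans ((mul_le_of_le_one_left hx0.le hδ).trans hxn)
      exact_mod_cast this
    have hm0 : (0 : ℝ) < m := by exact_mod_cast (by omega : 0 < m)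
    have hfin := Set.toFinite {f | F.IsBlockEmbedding (fun i : Fin n => (i : ℕ) / m) f}
    set C := hfin.toFinset with hC
    have h1 := real_log_numFreeOrientations_lt_le hH F hne hequiv hm2 hmn p hp C
      (fun f hf => hfin.mem_toFinset.2 hf) (fun f hf => (hfin.mem_toFinset.1 hf).1)
    refine (MeasureTheory.measureReal_mono fun G hG => ?_).trans (h1.trans ?_)
    · simp only [Set.mem_ofPred_eq] at hG ⊢
      refine hG.trans_le ?_
      have : (p : ℝ) * n / w * x = p * n * (64 * x / w) / 64 := by ring
      have h3 := mul_le_mul_of_nonneg_left hmge (mul_pos hp hn0).le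
      rw [this]
      linarith
    · have hCcard : (C.card : ℝ) ≤ (n : ℝ) ^ (s + 1) * (m : ℝ) ^ (d + 2) := by
        have h2 := ncard_blockMaps_le F.strongSetoid (n := n) (m := m) (by omega)
        rw [Nat.card_coe_set_eq] at h2
        change _ ≤ n ^ F.numStrongComps * m ^ (F.numVerts - F.numStrongComps) at h2
        rw [hs, hd, show s + d + 3 - (s + 1) = d + 2 by omega] at h2
        have h3 : C.card ≤ n ^ (s + 1) * m ^ (d + 2) := by
          refine le_trans ?_ h2
          rw [hC, ← Set.ncard_eq_toFinset_card _ hfin]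
          exact Set.ncard_le_ncard (fun f hf => hf.2) (Set.toFinite _)
        exact_mod_cast h3
      -- Up to constants, expected copies over expected in-block edges.
      have hratio : (m : ℝ) ^ (d + 1) * ((p : ℝ) ^ e * (n : ℝ) ^ s) ≤ 192 / w := by
        have h2 : (m : ℝ) ^ (d + 1) ≤ (192 / w * x) ^ (d + 1) := by gcongr
        calc (m : ℝ) ^ (d + 1) * ((p : ℝ) ^ e * (n : ℝ) ^ s)
            ≤ (192 / w * x) ^ (d + 1) * ((p : ℝ) ^ e * (n : ℝ) ^ s) := by gcongr
          _ = (192 / w) ^ (d + 1) := by rw [mul_pow, mul_assoc, hxpow, mul_one]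
          _ ≤ 192 / w := pow_le_of_le_one (by positivity) hδ (by omega)
      have hm2' : (2 : ℝ) ≤ m := by exact_mod_cast hm2
      have h4 : (32 : ℝ) / (n * m * p) ≤ 16 / (p * n) := by
        rw [div_le_div_iff₀ (by positivity) (by positivity)]
        nlinarith [mul_pos hp hn0]
      have h5 : (32 : ℝ) / (n * m * p) * (C.card * (p : ℝ) ^ F.numEdges) ≤ 6144 / w := by
        calc (32 : ℝ) / (n * m * p) * (C.card * (p : ℝ) ^ F.numEdges)
            ≤ 32 / (n * m * p) * ((n : ℝ) ^ (s + 1) * (m : ℝ) ^ (d + 2) * (p : ℝ) ^ (e + 1)) := by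
              rw [he]; gcongr
          _ = 32 * ((m : ℝ) ^ (d + 1) * ((p : ℝ) ^ e * (n : ℝ) ^ s)) := by
              field_simp
              ring
          _ ≤ 32 * (192 / w) := by gcongr
          _ = 6144 / w := by ring
      calc _ = 32 / (n * m * (p : ℝ)) +
            F.numEdges * (32 / (n * m * (p : ℝ)) * (C.card * (p : ℝ) ^ F.numEdges)) := by ring
        _ ≤ _ := add_le_add h4 (mul_le_mul_of_nonneg_left h5 (Nat.cast_nonneg _))

end Subgraph

/-! ### Consequences of the 2-density condition -/

section Density

lemma tendsto_mul_natCast_atTop (hm : 1 ≤ H.twoDensity) {p : ℕ → unitInterval}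
    (hp : Tendsto (fun n : ℕ => (p n : ℝ) / (n : ℝ) ^ (-1 / H.twoDensity)) atTop atTop) :
    Tendsto (fun n : ℕ => (p n : ℝ) * n) atTop atTop := by
  refine tendsto_atTop_mono' atTop ?_ hp
  filter_upwards [eventually_ge_atTop 1] with n hn
  have hn1 : (1 : ℝ) ≤ n := by exact_mod_cast hn
  have hn0 : (0 : ℝ) < n := by linarith
  rw [div_eq_mul_inv, ← Real.rpow_neg hn0.le]
  refine mul_le_mul_of_nonneg_left ?_ (p n).2.1
  calc (n : ℝ) ^ (-(-1 / H.twoDensity)) ≤ (n : ℝ) ^ (1 : ℝ) := by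
        refine Real.rpow_le_rpow_of_exponent_le hn1 ?_
        rw [neg_div, neg_neg]
        exact (div_le_one (by linarith)).2 hm
    _ = n := Real.rpow_one _

variable [Finite V]

lemma div_le_twoDensity (F : H.Subgraph) (hF : 3 ≤ F.numVerts) :
    ((F.numEdges : ℝ) - 1) / ((F.numVerts : ℝ) - 2) ≤ H.twoDensity := by
  refine le_csSup (Set.Finite.bddAbove ?_) ⟨F, hF, rfl⟩
  refine (Set.finite_range fun F : H.Subgraph =>
    ((F.numEdges : ℝ) - 1) / ((F.numVerts : ℝ) - 2)).subset ?_
  rintro x ⟨F, -, rfl⟩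
  exact ⟨F, rfl⟩

/-- The cycle itself. It shows that the 2-density is at least 1 and that the maximum in the lower
bound is over a nonempty set. -/
lemma HasDirectedCycle.exists_subgraph (h : H.HasDirectedCycle) :
    ∃ F : H.Subgraph, 3 ≤ F.numVerts ∧ F.numVerts ≤ F.numEdges ∧ F.numStrongComps = 1 := by
  obtain ⟨k, hk, c, hc, hadj⟩ := h
  have : NeZero k := ⟨by omega⟩
  let F : H.Subgraph :=
    { verts := Set.range c
      Adj := fun u v => ∃ i, u = c i ∧ v = c (i + 1)
      adj_sub := by rintro _ _ ⟨i, rfl, rfl⟩; exact hadj i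
      fst_mem := by rintro _ _ ⟨i, rfl, rfl⟩; exact ⟨i, rfl⟩
      snd_mem := by rintro _ _ ⟨i, rfl, rfl⟩; exact ⟨i + 1, rfl⟩ }
  have hv : F.numVerts = k := by
    change (Set.range c).ncard = k
    rw [← Set.image_univ, Set.ncard_image_of_injective _ hc, Set.ncard_univ, Nat.card_zmod]
  have he : k ≤ F.numEdges := by
    have : (Set.range fun i => (c i, c (i + 1))).ncard = k := by
      rw [← Set.image_univ, Set.ncard_image_of_injective _ (fun i j h => hc (congrArg Prod.fst h)),
        Set.ncard_univ, Nat.card_zmod]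
    rw [← this]
    refine Set.ncard_le_ncard ?_ (Set.toFinite _)
    rintro _ ⟨i, rfl⟩
    exact ⟨i, rfl, rfl⟩
  have hwalk : ∀ (t : ℕ) (i : ZMod k), Relation.ReflTransGen F.Adj (c i) (c (i + t)) := by
    intro t i
    induction t with
    | zero => rw [Nat.cast_zero, add_zero]
    | succ t ih => exact ih.tail ⟨i + t, rfl, by push_cast; rw [add_assoc]⟩
  have hwalk' : ∀ i j : ZMod k, Relation.ReflTransGen F.Adj (c i) (c j) := by
    intro i j
    have := hwalk (j - i).val i
    rwa [ZMod.natCast_zmod_val, add_sub_cancel] at this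
  refine ⟨F, by omega, by omega, ?_⟩
  refine Nat.card_eq_one_iff_unique.2 ⟨⟨fun a b => ?_⟩, ⟨⟦⟨c 0, 0, rfl⟩⟧⟩⟩
  induction a, b using Quotient.inductionOn₂ with | _ a b =>
  obtain ⟨_, i, rfl⟩ := a
  obtain ⟨_, j, rfl⟩ := b
  exact Quotient.sound ⟨hwalk' i j, hwalk' j i⟩

lemma HasDirectedCycle.one_le_twoDensity (h : H.HasDirectedCycle) : 1 ≤ H.twoDensity := by
  obtain ⟨F, h3, he, -⟩ := h.exists_subgraph
  refine le_trans ?_ (div_le_twoDensity F h3)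
  have h3' : (3 : ℝ) ≤ F.numVerts := by exact_mod_cast h3
  have he' : (F.numVerts : ℝ) ≤ F.numEdges := by exact_mod_cast he
  rw [le_div_iff₀ (by linarith)]
  linarith

/-- At the threshold value of `p` the exponent of `n` is v - 2 - (e - 1)/m₂, nonnegative by the
definition of m₂. -/
lemma one_le_pow_mul_pow (hm : 0 < H.twoDensity) (F : H.Subgraph) (hF : 3 ≤ F.numVerts)
    (he : 1 ≤ F.numEdges) {n : ℕ} (hn : 1 ≤ n) {p : ℝ}
    (hp : (n : ℝ) ^ (-1 / H.twoDensity) ≤ p) :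
    1 ≤ p ^ (F.numEdges - 1) * (n : ℝ) ^ (F.numVerts - 2) := by
  have hn1 : (1 : ℝ) ≤ n := by exact_mod_cast hn
  have hn0 : (0 : ℝ) < n := by linarith
  have h3' : (3 : ℝ) ≤ F.numVerts := by exact_mod_cast hF
  have h1 := div_le_twoDensity F hF
  rw [div_le_iff₀ (by linarith)] at h1
  calc (1 : ℝ) ≤ (n : ℝ) ^ ((-1 / H.twoDensity) * ((F.numEdges - 1 : ℕ) : ℝ) +
        ((F.numVerts - 2 : ℕ) : ℝ)) := by
        refine Real.one_le_rpow hn1 ?_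
        rw [Nat.cast_sub he, Nat.cast_sub (by omega)]
        push_cast
        have : ((F.numEdges : ℝ) - 1) / H.twoDensity ≤ F.numVerts - 2 := by
          rw [div_le_iff₀ hm]
          linarith
        have h2 : -1 / H.twoDensity * ((F.numEdges : ℝ) - 1) =
          -(((F.numEdges : ℝ) - 1) / H.twoDensity) := by ring
        rw [h2]
        linarith
    _ = ((n : ℝ) ^ (-1 / H.twoDensity)) ^ (F.numEdges - 1) * (n : ℝ) ^ (F.numVerts - 2) := by
        rw [Real.rpow_add hn0, Real.rpow_mul_natCast hn0.le, Real.rpow_natCast]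
    _ ≤ _ := by gcongr

lemma lowerBoundMax_le (h : H.HasDirectedCycle) {p : ℝ} {n : ℕ} {a : ℝ}
    (ha : ∀ F : H.Subgraph, F.numStrongComps + 2 ≤ F.numVerts → F.lowerBoundTerm p n ≤ a) :
    H.lowerBoundMax p n ≤ a := by
  obtain ⟨F, h3, -, hs⟩ := h.exists_subgraph
  refine csSup_le ⟨_, F, by omega, rfl⟩ ?_
  rintro x ⟨F, hF, rfl⟩
  exact ha F hF

end Density

end Digraph

/-! ### Union bound over the subgraphs of `H` -/

theorem proposition7p4 {V : Type*} [Finite V] (H : Digraph V) (hH : H.IsOriented)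
    (hcycle : H.HasDirectedCycle) (p : ℕ → unitInterval) (ω : ℕ → ℝ)
    (hp : Tendsto (fun n : ℕ => (p n : ℝ) / (n : ℝ) ^ (-1 / H.twoDensity)) atTop atTop)
    (hω : Tendsto ω atTop atTop) :
    Tendsto (fun n : ℕ => SimpleGraph.binomialRandom (Fin n) (p n)
      {G : SimpleGraph (Fin n) |
        (p n : ℝ) * n / ω n * H.lowerBoundMax (p n) n ≤
          Real.log (Digraph.numFreeOrientations G H)})
      atTop (𝓝 1) := by
  classical
  have := Fintype.ofFinite H.Subgraph
  have hm := hcycle.one_le_twoDensity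
  have hpn := Digraph.tendsto_mul_natCast_atTop hm hp
  set err : ℕ → ℝ := fun n => ∑ F : H.Subgraph,
    (16 / ((p n : ℝ) * n) + F.numEdges * (6144 / ω n)) with herr
  have herr0 : Tendsto err atTop (𝓝 0) := by
    have : Tendsto err atTop (𝓝 (∑ F : H.Subgraph, (0 + (F.numEdges : ℝ) * 0))) :=
      tendsto_finsetSum _ fun F _ => (hpn.const_div_atTop 16).add
        ((hω.const_div_atTop 6144).const_mul _)
    simpa using this
  have hbound : ∀ᶠ n : ℕ in atTop, 1 - err n ≤
      (SimpleGraph.binomialRandom (Fin n) (p n)).real {G : SimpleGraph (Fin n) |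
        (p n : ℝ) * n / ω n * H.lowerBoundMax (p n) n ≤
          Real.log (Digraph.numFreeOrientations G H)} := by
    filter_upwards [hp.eventually_ge_atTop 1, hω.eventually_ge_atTop 192, eventually_ge_atTop 2]
      with n hpn hωn hn
    have hn0 : (0 : ℝ) < n := by exact_mod_cast (by omega : 0 < n)
    have hpow : (0 : ℝ) < (n : ℝ) ^ (-1 / H.twoDensity) := Real.rpow_pos_of_pos hn0 _
    have hpge : (n : ℝ) ^ (-1 / H.twoDensity) ≤ p n := by
      rwa [le_div_iff₀ hpow, one_mul] at hpn
    have hp0 : 0 < (p n : ℝ) := hpow.trans_le hpge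
    have hω0 : 0 < ω n := by linarith
    set μ := SimpleGraph.binomialRandom (Fin n) (p n) with hμ
    set good := {G : SimpleGraph (Fin n) | (p n : ℝ) * n / ω n * H.lowerBoundMax (p n) n ≤
      Real.log (Digraph.numFreeOrientations G H)} with hgood
    -- If the bound holds for each admissible `F`, it holds for the supremum.
    have hcompl : goodᶜ ⊆ ⋃ F ∈ Finset.univ.filter
        (fun F : H.Subgraph => F.numStrongComps + 2 ≤ F.numVerts),
        {G : SimpleGraph (Fin n) | Real.log (Digraph.numFreeOrientations G H) <
          p n * n / ω n * F.lowerBoundTerm (p n) n} := by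
      intro G hG
      by_contra hcon
      refine hG ?_
      simp only [Set.mem_iUnion, Finset.mem_filter, Finset.mem_univ, true_and, Set.mem_ofPred_eq,
        not_exists, not_lt] at hcon
      rw [hgood, Set.mem_ofPred_eq, mul_comm, ← le_div_iff₀ (by positivity)]
      refine Digraph.lowerBoundMax_le hcycle fun F hF => ?_
      rw [le_div_iff₀ (by positivity), mul_comm]
      exact hcon F hF
    have hle : μ.real goodᶜ ≤ err n := by
      refine (MeasureTheory.measureReal_mono hcompl (MeasureTheory.measure_ne_top _ _)).trans
        ((MeasureTheory.measureReal_biUnion_finset_le _ _).trans ?_)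
      refine (Finset.sum_le_sum fun F hF => ?_).trans
        (Finset.sum_le_sum_of_subset_of_nonneg (Finset.filter_subset _ _)
          fun F _ _ => by positivity)
      have hF' := (Finset.mem_filter.1 hF).2
      obtain ⟨u, v, hne, hequiv⟩ :=
        Digraph.Subgraph.exists_ne_equiv_of_numStrongComps_lt (F := F) (by omega)
      have hs := Digraph.Subgraph.numStrongComps_pos (F := F) (by omega)
      exact Digraph.Subgraph.real_log_lt_lowerBoundTerm_le hH F hF' hn (p n) hp0 hωn
        (Digraph.one_le_pow_mul_pow (by linarith) F (by omega)
          (Digraph.Subgraph.numEdges_pos hne hequiv) (by omega) hpge)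
    rw [MeasureTheory.probReal_compl_eq_one_sub .of_discrete] at hle
    linarith
  have hlim : Tendsto (fun n : ℕ => (SimpleGraph.binomialRandom (Fin n) (p n)).real
      {G : SimpleGraph (Fin n) | (p n : ℝ) * n / ω n * H.lowerBoundMax (p n) n ≤
        Real.log (Digraph.numFreeOrientations G H)}) atTop (𝓝 1) := by
    refine tendsto_of_tendsto_of_tendsto_of_le_of_le' ?_ tendsto_const_nhds hbound
      (Eventually.of_forall fun n => MeasureTheory.measureReal_le_one)
    simpa using herr0.const_sub 1
  rw [← ENNReal.ofReal_one]
  exact (ENNReal.tendsto_ofReal hlim).congr fun n =>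
    ENNReal.ofReal_toReal (MeasureTheory.measure_ne_top _ _)
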